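/- **Setting.** Let $f:\mathbb{R}^n\to\mathbb{R}\cup\{+\infty\}$ and $g:\mathbb{R}^q\to\mathbb{R}\cup\{+\infty\}$ be proper and lower semicontinuous, $\mathbf A\in\mathbb{R}^{p\times n}$, $\mathbf B\in\mathbb{R}^{p\times q}$, $\mathbf c\in\mathbb{R}^p$, $\beta>0$ and $\gamma=1/\beta$. Consider $$\min_{\mathbf x,\mathbf z} f(\mathbf x)+g(\mathbf z)\quad\text{s.t. } \mathbf A\mathbf x-\mathbf B\mathbf z=\mathbf c,\tag{P}$$ and assume that for every $\mathbf t\in\mathbb{R}^p$ the problems $\min_{\mathbf x} f(\mathbf x)+\frac{1}{2\gamma}\|\mathbf A\mathbf x-\mathbf t\|^2$ and $\min_{\mathbf z} g(\mathbf z)+\frac1{2\gamma}\|\mathbf B\mathbf z+\mathbf c-\mathbf t\|^2$ have a solution. Set $$\varphi_1(\mathbf u)=\inf\{f(\mathbf x):\mathbf A\mathbf x=\mathbf u\},\qquad \varphi_2(\mathbf u)=\inf\{g(\mathbf z):\mathbf B\mathbf z+\mathbf c=\mathbf u\}$$ (with $\inf\emptyset=+\infty$). For $h:\mathbb R^p\to[-\infty,+\infty]$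 let $\mathrm{prox}_h(\mathbf s)=\arg\min_{\mathbf y}\big(h(\mathbf y)+\frac12\|\mathbf s-\mathbf y\|^2\big)$, a set. The (set-valued) DR map is $\mathcal G=\frac12\big((2\,\mathrm{prox}_{\gamma\varphi_2}-\mathbf I)\circ(2\,\mathrm{prox}_{\gamma\varphi_1}-\mathbf I)+\mathbf I\big)$, i.e. $\mathcal G(\mathbf s)=\{\mathbf s+\mathbf v-\mathbf u:\mathbf u\in\mathrm{prox}_{\gamma\varphi_1}(\mathbf s),\ \mathbf v\in\mathrm{prox}_{\gamma\varphi_2}(2\mathbf u-\mathbf s)\}$; $\mathbf s^*$ is a fixed point of $\mathcal G$ if $\mathbf s^*\in\mathcal G(\mathbf s^*)$. The DR envelope is $$\varphi^{DR}(\mathbf s)=\min_{\mathbf w}\Big(\varphi_1(\mathbf u)+\varphi_2(\mathbf w)+\langle\nabla\varphi_1(\mathbf u),\mathbf w-\mathbf u\rangle+\tfrac1{2\gamma}\|\mathbf w-\mathbf u\|^2\Big),\qquad \mathbf u=\mathrm{prox}_{\gamma\varphi_1}(\mathbf s).$$ Let $\partial$ denote the general (limiting) subdifferential. A point $\mathbf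 u^*$ is stationary for $\min\varphi_1+\varphi_2$ if $0\in\partial\varphi_1(\mathbf u^*)+\partial\varphi_2(\mathbf u^*)$; a triple $(\mathbf x^*,\mathbf y^*,\mathbf z^*)$ is stationary for (P) if $\mathbf A\mathbf x^*-\mathbf B\mathbf z^*=\mathbf c$, $-\beta\mathbf A^T\mathbf y^*\in\partial f(\mathbf x^*)$ and $\beta\mathbf B^T\mathbf y^*\in\partial g(\mathbf z^*)$. A function is level-bounded if all its sublevel sets at real levels are bounded. **Algorithm.** Given $m\in\mathbb{N}$, constants $\nu_1,\nu_2$ and initial values $\mathbf x_{\rm init},\mathbf y_{\rm init}$, put $\mathbf s_0=\mathbf A\mathbf x_{\rm init}-\mathbf y_{\rm init}$. For $k=0,1,2,\dots$ (without termination): * choose $\mathbf x_k\in\arg\min_{\mathbf x} f(\mathbf x)+\frac1{2\gamma}\|\mathbf A\mathbf x-\mathbf s_k\|^2$ and put $\mathbf u_k=\mathbf A\mathbf x_k$; choose $\mathbf z_k\in\arg\min_{\mathbf z}g(\mathbf z)+\frac1{2\gamma}\|\mathbf B\mathbf z+\mathbf c-(2\mathbf u_k-\mathbf s_k)\|^2$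 and put $\mathbf v_k=\mathbf B\mathbf z_k+\mathbf c$; * put $\mathbf g_k=\mathbf s_k+\mathbf v_k-\mathbf u_k$, $\mathbf f_k=\mathbf g_k-\mathbf s_k$, $\bar m=\min(m,k)$; choose $\theta^*\in\arg\min_{\theta\in\mathbb{R}^{\bar m}}\|\mathbf f_k-\sum_{j=1}^{\bar m}\theta_j(\mathbf f_{k-j+1}-\mathbf f_{k-j})\|^2$ and put $\mathbf s_{AA}=\mathbf g_k-\sum_{j=1}^{\bar m}\theta_j^*(\mathbf g_{k-j+1}-\mathbf g_{k-j})$; * if $\varphi^{DR}(\mathbf s_{AA})-\varphi^{DR}(\mathbf s_k)\le-\nu_1\|\mathbf g_k-\mathbf s_k\|^2-\nu_2\|\mathbf s_{AA}-\mathbf s_k\|^2$, set $\mathbf s_{k+1}=\mathbf s_{AA}$; otherwise set $\mathbf s_{k+1}=\mathbf g_k$. **Theorem.** Assume * (A.1) $\varphi_1$ is finite and differentiable on $\mathbb R^p$ and, for some $L$ and some $\sigma\in[-L,L]$, $\|\nabla\varphi_1(\mathbf x)-\nabla\varphi_1(\mathbf y)\|\le L\|\mathbf x-\mathbf y\|$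 and $\langle\nabla\varphi_1(\mathbf x)-\nabla\varphi_1(\mathbf y),\mathbf x-\mathbf y\rangle\ge\sigma\|\mathbf x-\mathbf y\|^2$ for all $\mathbf x,\mathbf y$; * (A.2) $\varphi_2$ is lower semicontinuous and proper; * (A.3) $\min_{\mathbf u}\varphi_1(\mathbf u)+\varphi_2(\mathbf u)$ has a solution; * (B.1) $\nu_1>0$ and $\nu_2\ge0$; * (B.2) $\varphi_1+\varphi_2$ is level-bounded; * (B.3) $\gamma<\min\big\{\frac1{2\max\{-\sigma,0\}},\frac1L\big\}$, where $1/0=+\infty$. Let $(\mathbf s_k,\mathbf u_k,\mathbf v_k,\mathbf x_k,\mathbf z_k)_{k\ge0}$ be any sequences generated by the algorithm. Then: (a) The values $\varphi^{DR}(\mathbf s_k)$ are finite and monotonically decreasing (nonincreasing) in $k$, and $\|\mathbf v_k-\mathbf u_k\|\to0$. (b) The sequence $(\mathbf s_k,\mathbf u_k,\mathbf v_k)$ is bounded. If a subsequence $\mathbf s_{k_i}$ converges to $\mathbf s^*$, then $\mathbf s^*$ is a fixed point of $\mathcal G$, the set $\mathrm{prox}_{\gamma\varphi_1}(\mathbf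 s^*)$ consists of a single point $\mathbf u^*$, and $\mathbf u^*$ is stationary for $\min\varphi_1+\varphi_2$. Such a convergent subsequence exists. (c) Assume in addition (B.4): for every $\mathbf s\in\mathbb{R}^p$ the function $\mathbf z\mapsto g(\mathbf z)+\frac\beta2\|\mathbf B\mathbf z+\mathbf c-\mathbf s\|^2$ is level-bounded and bounded from below. Let $\mathbf s_{k_i}\to\mathbf s^*$ be any convergent subsequence as in (b). Then the corresponding subsequence $\{\mathbf z_{k_i}\}$ is bounded and hence has a cluster point. For every cluster point $\mathbf z^*$ of $\{\mathbf z_{k_i}\}$, every $\mathbf x^*\in\arg\min_{\mathbf x} f(\mathbf x)+\frac\beta2\|\mathbf A\mathbf x-\mathbf s^*\|^2$, and $\mathbf y^*=\mathbf u^*-\mathbf s^*$ with $\mathbf u^*=\mathrm{prox}_{\gamma\varphi_1}(\mathbf s^*)$, the triple $(\mathbf x^*,\mathbf y^*,\mathbf z^*)$ is a stationary point of (P). -/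

import Mathlib

open Filter Topology

noncomputable section

namespace AADR

section General

variable {X Z E : Type*}
  [NormedAddCommGroup X] [InnerProductSpace ℝ X]
  [NormedAddCommGroup Z] [InnerProductSpace ℝ Z]
  [NormedAddCommGroup E] [InnerProductSpace ℝ E]

/-- The set of global minimizers. -/
def argMin {T : Type*} (F : T → EReal) : Set T := {y | ∀ w, F y ≤ F w}

/-- Proper extended-real-valued function: never `-∞` and not identically `+∞`. -/
def Proper {T : Type*} (F : T → EReal) : Prop := (∀ x, F x ≠ ⊥) ∧ ∃ x, F x ≠ ⊤

/-- Level-bounded: every sublevel set at a real level is bounded. -/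
def LevelBounded (F : E → EReal) : Prop :=
  ∀ α : ℝ, Bornology.IsBounded {x | F x ≤ (α : EReal)}

/-- The image function `s ↦ inf {f y | A y = s}`; it is `+∞` off the range of `A`. -/
def imageFun (A : X →L[ℝ] E) (f : X → EReal) (s : E) : EReal :=
  ⨅ (y : X) (_ : A y = s), f y

/-- The set-valued proximal mapping of `h`. -/
def prox (h : E → EReal) (x : E) : Set E :=
  argMin fun y => h y + (((1 / 2 : ℝ) * ‖x - y‖ ^ 2 : ℝ) : EReal)

/-- The set-valued proximal mapping of `γ φ`. -/
def proxScaled (γ : ℝ) (φ : E → EReal) : E → Set E :=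
  prox fun y => (γ : EReal) * φ y

/-- The gradient of a (finite) extended-real-valued function. -/
def grad [CompleteSpace E] (φ : E → EReal) (x : E) : E :=
  gradient (fun y => (φ y).toReal) x

/-- `L`-smooth: finite everywhere, differentiable, with `L`-Lipschitz gradient. -/
def IsLSmooth [CompleteSpace E] (L : ℝ) (φ : E → EReal) : Prop :=
  (∀ x, φ x ≠ ⊥ ∧ φ x ≠ ⊤) ∧ Differentiable ℝ (fun y => (φ y).toReal) ∧
    ∀ x y, ‖grad φ x - grad φ y‖ ≤ L * ‖x - y‖

/-- `σ`-hypoconvex: finite everywhere, differentiable, and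
`⟪∇φ x - ∇φ y, x - y⟫ ≥ σ ‖x - y‖²`. -/
def IsHypoconvex [CompleteSpace E] (σ : ℝ) (φ : E → EReal) : Prop :=
  (∀ x, φ x ≠ ⊥ ∧ φ x ≠ ⊤) ∧ Differentiable ℝ (fun y => (φ y).toReal) ∧
    ∀ x y, σ * ‖x - y‖ ^ 2 ≤ inner ℝ (grad φ x - grad φ y) (x - y)

/-- Regular (Fréchet) subgradients: `F x ≥ F x₀ + ⟪w, x - x₀⟫ + o(‖x - x₀‖)`, with `F x₀` finite. -/
def regularSubdifferential (F : E → EReal) (x₀ : E) : Set E :=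
  {w | F x₀ ≠ ⊥ ∧ F x₀ ≠ ⊤ ∧ ∀ ε : ℝ, 0 < ε →
    ∀ᶠ x in 𝓝 x₀, F x₀ + ((inner ℝ w (x - x₀) - ε * ‖x - x₀‖ : ℝ) : EReal) ≤ F x}

/-- General (limiting, Mordukhovich) subgradients: limits of regular subgradients `w i` taken at
points `a i → x₀` with `F (a i) → F x₀`, where `F x₀` is finite. -/
def subdifferential (F : E → EReal) (x₀ : E) : Set E :=
  {w | F x₀ ≠ ⊥ ∧ F x₀ ≠ ⊤ ∧ ∃ (a : ℕ → E) (b : ℕ → E),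
    Tendsto a atTop (𝓝 x₀) ∧ Tendsto (fun i => F (a i)) atTop (𝓝 (F x₀)) ∧
    (∀ i, b i ∈ regularSubdifferential F (a i)) ∧ Tendsto b atTop (𝓝 w)}

/-- `u` is a stationary point of `min φ₁ + φ₂`, i.e. `0 ∈ ∂φ₁(u) + ∂φ₂(u)`. -/
def IsStationaryDR (φ₁ φ₂ : E → EReal) (u : E) : Prop :=
  ∃ a ∈ subdifferential φ₁ u, ∃ b ∈ subdifferential φ₂ u, a + b = 0

/-- `(x, y, z)` is a stationary point of `min f x + g z` subject to `A x - B z = c`, with scaled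
multiplier `y` and penalty `β`; the transpose of a matrix is the adjoint of its linear map. -/
def IsStationaryADMM [CompleteSpace X] [CompleteSpace Z] [CompleteSpace E]
    (f : X → EReal) (g : Z → EReal) (A : X →L[ℝ] E) (B : Z →L[ℝ] E) (c : E) (β : ℝ)
    (x : X) (y : E) (z : Z) : Prop :=
  A x - B z = c ∧
    -(β • ContinuousLinearMap.adjoint A y) ∈ subdifferential f x ∧
    β • ContinuousLinearMap.adjoint B y ∈ subdifferential g z

/-- The set-valued Douglas–Rachford map
`𝒢 = ½ ((2 prox_{γφ₂} - I) ∘ (2 prox_{γφ₁} - I) + I)`. -/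
def drMap (γ : ℝ) (φ₁ φ₂ : E → EReal) (s : E) : Set E :=
  {t | ∃ u ∈ proxScaled γ φ₁ s, ∃ v ∈ proxScaled γ φ₂ ((2 : ℝ) • u - s),
    t = (1 / 2 : ℝ) • (((2 : ℝ) • v - ((2 : ℝ) • u - s)) + s)}

/-- The quantity minimized over `w` in the DR envelope, based at `u`. -/
def envelopeModel [CompleteSpace E] (γ : ℝ) (φ₁ φ₂ : E → EReal) (u w : E) : EReal :=
  φ₁ u + φ₂ w +
    ((inner ℝ (grad φ₁ u) (w - u) + 1 / (2 * γ) * ‖w - u‖ ^ 2 : ℝ) : EReal)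

/-- The DR envelope at `s`: the minimum over `w` of the model based at `u = prox_{γφ₁}(s)`.
(Where `prox_{γφ₁}(s)` is the singleton `{u}`, the outer infimum is over that one point.) -/
def drEnvelope [CompleteSpace E] (γ : ℝ) (φ₁ φ₂ : E → EReal) (s : E) : EReal :=
  ⨅ (u : E) (_ : u ∈ proxScaled γ φ₁ s), ⨅ w : E, envelopeModel γ φ₁ φ₂ u w

/-- Solutions of the `x`-subproblem `min f x + (1/2γ) ‖A x - s‖²`. -/
def xSolutions (γ : ℝ) (f : X → EReal) (A : X →L[ℝ] E) (s : E) : Set X :=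
  argMin fun x => f x + ((1 / (2 * γ) * ‖A x - s‖ ^ 2 : ℝ) : EReal)

/-- Solutions of the `z`-subproblem `min g z + (1/2γ) ‖B z + c - s‖²`. -/
def zSolutions (γ : ℝ) (g : Z → EReal) (B : Z →L[ℝ] E) (c : E) (s : E) : Set Z :=
  argMin fun z => g z + ((1 / (2 * γ) * ‖B z + c - s‖ ^ 2 : ℝ) : EReal)

/-- `θ` solves the Anderson least-squares problem at step `k` for the residuals `F`: it minimizes
`‖F k - ∑_{j=1}^{m̄} θ_j (F (k-j+1) - F (k-j))‖²`, where `m̄ = min m k` (here `j` starts at `0`). -/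
def IsAndersonCoeff (m : ℕ) (F : ℕ → E) (k : ℕ) (θ : Fin (min m k) → ℝ) : Prop :=
  ∀ θ' : Fin (min m k) → ℝ,
    ‖F k - ∑ j : Fin (min m k), θ j • (F (k - (j : ℕ)) - F (k - ((j : ℕ) + 1)))‖ ^ 2 ≤
    ‖F k - ∑ j : Fin (min m k), θ' j • (F (k - (j : ℕ)) - F (k - ((j : ℕ) + 1)))‖ ^ 2

/-- The Anderson-accelerated candidate `G k - ∑_{j=1}^{m̄} θ_j (G (k-j+1) - G (k-j))`. -/
def andersonPoint (m : ℕ) (G : ℕ → E) (k : ℕ) (θ : Fin (min m k) → ℝ) : E :=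
  G k - ∑ j : Fin (min m k), θ j • (G (k - (j : ℕ)) - G (k - ((j : ℕ) + 1)))

/-- Acceptance test for a candidate `t` from `s`, with `g = 𝒢(s)` the un-accelerated step:
`φ^DR(t) - φ^DR(s) ≤ -ν₁ ‖g - s‖² - ν₂ ‖t - s‖²`. -/
def Accepted [CompleteSpace E] (γ ν₁ ν₂ : ℝ) (φ₁ φ₂ : E → EReal) (s g t : E) : Prop :=
  drEnvelope γ φ₁ φ₂ t + ((ν₁ * ‖g - s‖ ^ 2 + ν₂ * ‖t - s‖ ^ 2 : ℝ) : EReal)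
    ≤ drEnvelope γ φ₁ φ₂ s

/-- The sequences of accepted iterates of the accelerated DR algorithm run without termination
from `xInit, yInit`. Each step solves the two subproblems at `s k` (any solutions), forms an
Anderson candidate from any least-squares solution, takes it as `s (k + 1)` if it passes the
acceptance test, and otherwise falls back on the un-accelerated step `s k + v k - u k`. -/
structure IsRun [CompleteSpace E] (f : X → EReal) (g : Z → EReal)
    (A : X →L[ℝ] E) (B : Z →L[ℝ] E) (c : E) (γ ν₁ ν₂ : ℝ) (m : ℕ) (xInit : X) (yInit : E)
    (s u v : ℕ → E) (x : ℕ → X) (z : ℕ → Z) : Prop where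
  init : s 0 = A xInit - yInit
  x_mem : ∀ k, x k ∈ xSolutions γ f A (s k)
  u_eq : ∀ k, u k = A (x k)
  z_mem : ∀ k, z k ∈ zSolutions γ g B c ((2 : ℝ) • u k - s k)
  v_eq : ∀ k, v k = B (z k) + c
  step : ∀ k, ∃ θ : Fin (min m k) → ℝ,
    IsAndersonCoeff m (fun i => v i - u i) k θ ∧
    ((Accepted γ ν₁ ν₂ (imageFun A f) (fun t => imageFun B g (t - c)) (s k) (s k + v k - u k)
        (andersonPoint m (fun i => s i + v i - u i) k θ) ∧
      s (k + 1) = andersonPoint m (fun i => s i + v i - u i) k θ) ∨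
     (¬ Accepted γ ν₁ ν₂ (imageFun A f) (fun t => imageFun B g (t - c)) (s k) (s k + v k - u k)
        (andersonPoint m (fun i => s i + v i - u i) k θ) ∧
      s (k + 1) = s k + v k - u k))

end General

end AADR

end

/-!
Write `φ₁` and `φ₂` for the image functions of `f` and `g`. Solving the `x`- and `z`-subproblems
amounts to taking proximal steps on `φ₁` and `φ₂` (`imageFun_of_mem_zSolutions`), so the algorithm
is an accelerated Douglas–Rachford iteration for `min φ₁ + φ₂`, and the DR envelope is its merit
function.

The heart of the proof is that an un-accelerated step `s ↦ s + v - u` decreases the envelope by at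
least a positive multiple of `‖v - u‖²`. Let `u'` be the proximal point of `φ₁` at `s + v - u`, and
put `d = u' - u`, `e = ∇φ₁ u' - ∇φ₁ u`. Then `v - u = d + γ e` and `v - u' = γ e`, and bounding the
new envelope by its model at `w = v` leaves `ρ + ‖d‖² / (2γ) - γ ‖e‖²`, where `ρ` is the
linearization gap of `φ₁`. Hypoconvexity bounds `ρ` below by `σ ‖d‖² / 2`, and the interpolation
inequality by `(σ L ‖d‖² + ‖e‖²) / (2 (L + σ))`; together with `‖e‖ ≤ L ‖d‖` these make the
expression coercive in `d` throughout the admissible range of `γ` (`step_size_inequality`,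
`sufficient_decrease_smooth`, `drEnvelope_decrease`). An accepted Anderson candidate decreases the
envelope by the acceptance test, so only this common decrease matters (`IsDescentRun`).

Since `γ L < 1`, the descent lemma gives `φ₁ v + φ₂ v ≤ φ^DR s`. Hence the envelope is bounded below
along the run, the residuals `v - u` tend to zero, and level-boundedness makes the iterates bounded.
The proximal mapping of `φ₁` is single-valued and Lipschitz, so along a convergent subsequence of
`s` both `u` and `v` converge to the same point `u'`. Minimizers of lower semicontinuous functions
with converging quadratic perturbations converge to minimizers (`mem_zSolutions_of_tendsto`), which
gives the fixed point and the limiting `z`-subproblem. All stationarity claims are then instances of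
one fact: a minimizer of `g + ‖B · + c - s‖² / (2γ)` has the subgradient
`γ⁻¹ Bᵀ (s - (B z + c))` (`subgradient_of_mem_zSolutions`).
-/

namespace AADR

/-! ### Smooth hypoconvex functions -/

section Smooth

variable {E : Type*} [NormedAddCommGroup E] [InnerProductSpace ℝ E]

/-- Along the segment from `x` to `y`, subtracting the quadratic model leaves a function with
nonnegative derivative. No sign is required of `σ`. -/
theorem quadratic_lower_bound [CompleteSpace E] {F : E → ℝ} {G : E → E} {σ : ℝ}
    (hG : ∀ x, HasGradientAt F (G x) x)
    (hmono : ∀ x y, σ * ‖x - y‖ ^ 2 ≤ inner ℝ (G x - G y) (x - y)) (x y : E) :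
    F x + inner ℝ (G x) (y - x) + σ / 2 * ‖y - x‖ ^ 2 ≤ F y := by
  set d := y - x with hd
  let q : ℝ → ℝ := fun t => F (x + t • d) - t * inner ℝ (G x) d - σ / 2 * t ^ 2 * ‖d‖ ^ 2
  have hq : ∀ t, HasDerivAt q
      (inner ℝ (G (x + t • d)) d - inner ℝ (G x) d - σ * t * ‖d‖ ^ 2) t := by
    intro t
    have h1 : HasDerivAt (fun t : ℝ => x + t • d) d t := by
      simpa using ((hasDerivAt_id t).smul_const d).const_add x
    have h2 := (hG (x + t • d)).hasFDerivAt.comp_hasDerivAt t h1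
    rw [InnerProductSpace.toDual_apply_apply] at h2
    have h3 := (hasDerivAt_id t).mul_const (inner ℝ (G x) d)
    have h4 := (((hasDerivAt_id t).pow 2).const_mul (σ / 2)).mul_const (‖d‖ ^ 2)
    refine ((h2.sub h3).sub h4).congr_deriv ?_
    simp only [id_eq, Nat.cast_ofNat, Nat.add_one_sub_one, pow_one]
    ring
  have hmon : MonotoneOn q (Set.Icc 0 1) := by
    apply monotoneOn_of_deriv_nonneg (convex_Icc 0 1)
    · exact fun t _ => (hq t).continuousAt.continuousWithinAt
    · exact fun t _ => (hq t).differentiableAt.differentiableWithinAt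
    · intro t ht
      rw [interior_Icc] at ht
      rw [(hq t).deriv]
      have h := hmono (x + t • d) x
      rw [add_sub_cancel_left, norm_smul, inner_smul_right, inner_sub_left, mul_pow,
        Real.norm_eq_abs, sq_abs] at h
      have ht0 := ht.1
      by_contra hneg
      nlinarith [mul_pos ht0 (sub_pos.2 (not_le.1 hneg))]
  have h01 := hmon (Set.left_mem_Icc.2 zero_le_one) (Set.right_mem_Icc.2 zero_le_one) zero_le_one
  simp only [q, zero_smul, one_smul, add_zero] at h01
  rw [show x + d = y by simp [hd]] at h01
  linarith

/-- The descent lemma: `-F` is hypoconvex with modulus `-L`. -/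
theorem quadratic_upper_bound [CompleteSpace E] {F : E → ℝ} {G : E → E} {L : ℝ}
    (hG : ∀ x, HasGradientAt F (G x) x)
    (hLip : ∀ x y, ‖G x - G y‖ ≤ L * ‖x - y‖) (x y : E) :
    F y ≤ F x + inner ℝ (G x) (y - x) + L / 2 * ‖y - x‖ ^ 2 := by
  have h := quadratic_lower_bound (F := fun z => -F z) (G := fun z => -G z) (σ := -L)
    (fun z => by
      have := (hG z).hasFDerivAt.neg
      rw [hasGradientAt_iff_hasFDerivAt, map_neg]
      exact this)
    (fun a b => by
      have h1 := (abs_le.1 (abs_real_inner_le_norm (G a - G b) (a - b))).2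
      have h2 := mul_le_mul_of_nonneg_right (hLip a b) (norm_nonneg (a - b))
      rw [← neg_sub', inner_neg_left]
      nlinarith) x y
  simp only [inner_neg_left] at h
  linarith

/-- The interpolation inequality of smooth hypoconvex functions: the lower model at `x` is compared
with the upper model at `y`, at the point `y - (L - σ)⁻¹ (e - σ d)` where the gap between the
two is largest; here `d = y - x` and `e` is the difference of the gradients. -/
theorem interpolation_inequality [CompleteSpace E] {F : E → ℝ} {G : E → E} {L σ : ℝ}
    (hG : ∀ x, HasGradientAt F (G x) x)
    (hLip : ∀ x y, ‖G x - G y‖ ≤ L * ‖x - y‖)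
    (hmono : ∀ x y, σ * ‖x - y‖ ^ 2 ≤ inner ℝ (G x - G y) (x - y))
    (hσL : σ < L) (x y : E) :
    σ * L * ‖y - x‖ ^ 2 + ‖G y - G x‖ ^ 2 - 2 * σ * inner ℝ (G y - G x) (y - x) ≤
      2 * (L - σ) * (F y - F x - inner ℝ (G x) (y - x)) := by
  have hLσ : 0 < L - σ := sub_pos.2 hσL
  obtain ⟨d, rfl⟩ : ∃ d, y = x + d := ⟨y - x, by simp⟩
  obtain ⟨w, hw⟩ : ∃ w, G (x + d) = G x + σ • d + (L - σ) • w :=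
    ⟨(L - σ)⁻¹ • (G (x + d) - G x - σ • d), by
      rw [smul_inv_smul₀ hLσ.ne']; abel⟩
  have h1 := quadratic_lower_bound hG hmono x (x + d - w)
  have h2 := quadratic_upper_bound hG hLip (x + d) (x + d - w)
  rw [show x + d - w - x = d - w by abel] at h1
  rw [show x + d - w - (x + d) = -w by abel, hw] at h2
  rw [hw, show G x + σ • d + (L - σ) • w - G x = σ • d + (L - σ) • w by abel,
    add_sub_cancel_left]
  rw [norm_add_sq_real]
  rw [norm_sub_sq_real, inner_sub_right] at h1
  simp only [inner_add_left, inner_smul_left, inner_smul_right, inner_neg_right, norm_neg,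
    norm_smul, mul_pow, Real.norm_eq_abs, sq_abs, real_inner_self_eq_norm_sq, conj_trivial,
    real_inner_comm d w] at h1 h2 ⊢
  have h3 := mul_le_mul_of_nonneg_left (h1.trans h2) hLσ.le
  nlinarith

/-- The two lower bounds on `ρ` are active for `E ≤ σ² D` and `E ≥ σ² D` respectively, so the worst
cases are `E = σ² D` and `E = L² D`, which the two bounds on the step size `γ` cover. -/
theorem step_size_inequality {γ L σ D E ρ : ℝ} (hγ : 0 < γ) (hσL : -L < σ)
    (hED : E ≤ L ^ 2 * D) (h1 : σ * D ≤ 2 * ρ)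
    (h2 : σ * L * D + E ≤ 2 * (L + σ) * ρ) (hD : 0 ≤ D) :
    min ((1 - γ * L) * (1 + 2 * γ * L)) ((1 - γ * σ) * (1 + 2 * γ * σ)) * D ≤
      2 * γ * ρ + D - 2 * γ ^ 2 * E := by
  set c := min ((1 - γ * L) * (1 + 2 * γ * L)) ((1 - γ * σ) * (1 + 2 * γ * σ))
  have hcL := mul_le_mul_of_nonneg_right
    (min_le_left _ _ : c ≤ (1 - γ * L) * (1 + 2 * γ * L)) hD
  have hcσ := mul_le_mul_of_nonneg_right
    (min_le_right _ _ : c ≤ (1 - γ * σ) * (1 + 2 * γ * σ)) hD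
  have hLσ : 0 < L + σ := by linarith
  rcases le_total E (σ ^ 2 * D) with hE | hE
  · have h3 := mul_le_mul_of_nonneg_left hE (by positivity : 0 ≤ 2 * γ ^ 2)
    have h4 := mul_le_mul_of_nonneg_left h1 hγ.le
    linarith
  · refine le_of_mul_le_mul_left ?_ hLσ
    have h3 := mul_le_mul_of_nonneg_left h2 hγ.le
    -- after multiplication by `L + σ` the lower bound is affine in `E`
    rcases le_total 0 (γ - 2 * γ ^ 2 * (L + σ)) with hk | hk
    · have h4 := mul_le_mul_of_nonneg_left hE hk
      have h5 := mul_le_mul_of_nonneg_left hcσ hLσ.le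
      linarith
    · have h4 := mul_le_mul_of_nonpos_left hED hk
      have h5 := mul_le_mul_of_nonneg_left hcL hLσ.le
      linarith

/-- The constant of sufficient decrease of one Douglas–Rachford step. The minimum is the coercivity
constant of `2 γ` times the decrease in terms of `‖d‖²`, and `(1 + γ L)²` comes from
`‖d + γ e‖ ≤ (1 + γ L) ‖d‖`. -/
noncomputable def decreaseConst (γ L σ : ℝ) : ℝ :=
  min ((1 - γ * L) * (1 + 2 * γ * L)) ((1 - γ * σ) * (1 + 2 * γ * σ)) / (2 * γ * (1 + γ * L) ^ 2)

theorem decreaseConst_pos {γ L σ : ℝ} (hγ : 0 < γ) (hL : 0 < L) (hσ : σ ≤ 0)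
    (hγL : γ * L < 1) (hγσ : -(2 * γ * σ) < 1) : 0 < decreaseConst γ L σ := by
  have hγL0 : 0 < γ * L := mul_pos hγ hL
  have hγσ0 : γ * σ ≤ 0 := mul_nonpos_of_nonneg_of_nonpos hγ.le hσ
  refine div_pos (lt_min (mul_pos ?_ ?_) (mul_pos ?_ ?_)) (by positivity) <;> nlinarith

theorem sufficient_decrease_smooth [CompleteSpace E] {F : E → ℝ} {G : E → E} {γ L σ : ℝ}
    (hG : ∀ x, HasGradientAt F (G x) x)
    (hLip : ∀ x y, ‖G x - G y‖ ≤ L * ‖x - y‖)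
    (hmono : ∀ x y, σ * ‖x - y‖ ^ 2 ≤ inner ℝ (G x - G y) (x - y))
    (hγ : 0 < γ) (hL : 0 < L) (hσL : -L < σ) (hσ : σ ≤ 0) (hγL : γ * L < 1)
    (hγσ : -(2 * γ * σ) < 1) (x y : E) :
    decreaseConst γ L σ * ‖(y - x) + γ • (G y - G x)‖ ^ 2 ≤
      F x - F y - inner ℝ (G y) (x - y) + 1 / (2 * γ) * ‖y - x‖ ^ 2
        - γ * ‖G y - G x‖ ^ 2 := by
  have hLσ : 0 < L - σ := by linarith
  have i1 := interpolation_inequality hG hLip hmono (by linarith) y x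
  have i2 := interpolation_inequality hG hLip hmono (by linarith) x y
  have i3 := quadratic_lower_bound hG hmono y x
  have hin : inner ℝ (G x - G y) (x - y) = inner ℝ (G y - G x) (y - x) := by
    rw [← neg_sub (G y), ← neg_sub y, inner_neg_neg]
  have hP : inner ℝ (G y - G x) (y - x) = -inner ℝ (G y) (x - y) - inner ℝ (G x) (y - x) := by
    rw [inner_sub_left, ← neg_sub y x, inner_neg_right]; ring
  rw [hin, norm_sub_rev x y, norm_sub_rev (G x)] at i1
  rw [norm_sub_rev x y] at i3
  have hE : ‖G y - G x‖ ^ 2 ≤ L ^ 2 * ‖y - x‖ ^ 2 := by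
    rw [← mul_pow]; exact pow_le_pow_left₀ (norm_nonneg _) (hLip y x) 2
  have hn : ‖(y - x) + γ • (G y - G x)‖ ^ 2 ≤ (1 + γ * L) ^ 2 * ‖y - x‖ ^ 2 := by
    rw [← mul_pow]
    refine pow_le_pow_left₀ (norm_nonneg _) ((norm_add_le _ _).trans ?_) 2
    rw [norm_smul, Real.norm_of_nonneg hγ.le]
    nlinarith [mul_le_mul_of_nonneg_left (hLip y x) hγ.le]
  set D := ‖y - x‖ ^ 2
  set e := ‖G y - G x‖ ^ 2
  set P : ℝ := inner ℝ (G y - G x) (y - x)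
  set ρ := F x - F y - inner ℝ (G y) (x - y) with hρ
  -- adding the two interpolation inequalities gives the cocoercivity bound on `P`
  have hPlow : σ * L * D + e ≤ (L + σ) * P := by
    have : (L - σ) * P = (L - σ) * ρ + (L - σ) * (F y - F x - inner ℝ (G x) (y - x)) := by
      rw [hP, hρ]; ring
    linarith
  have h2 : σ * L * D + e ≤ 2 * (L + σ) * ρ := by
    refine le_of_mul_le_mul_left ?_ hLσ
    have h3 := mul_le_mul_of_nonneg_left hPlow (by linarith : 0 ≤ -(2 * σ))
    have h4 := mul_le_mul_of_nonneg_left i1 (by linarith : 0 ≤ L + σ)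
    linarith
  have hk := step_size_inequality hγ hσL hE (by linarith) h2 (by positivity)
  calc _ ≤ decreaseConst γ L σ * ((1 + γ * L) ^ 2 * D) :=
        mul_le_mul_of_nonneg_left hn (decreaseConst_pos hγ hL hσ hγL hγσ).le
    _ = min ((1 - γ * L) * (1 + 2 * γ * L)) ((1 - γ * σ) * (1 + 2 * γ * σ)) * D / (2 * γ) := by
        have : 0 < 1 + γ * L := by positivity
        rw [decreaseConst]; field_simp
    _ ≤ (2 * γ * ρ + D - 2 * γ ^ 2 * e) / (2 * γ) :=
        div_le_div_of_nonneg_right hk (by positivity)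
    _ = _ := by field_simp

end Smooth

/-! ### Quadratically perturbed minimization problems -/

section Prox

variable {X Z E : Type*}
  [NormedAddCommGroup X] [InnerProductSpace ℝ X]
  [NormedAddCommGroup Z] [InnerProductSpace ℝ Z]
  [NormedAddCommGroup E] [InnerProductSpace ℝ E]

theorem scaled_add_coe_le_iff {γ : ℝ} (hγ : 0 < γ) (a b : EReal) (r r' : ℝ) :
    (γ : EReal) * a + r ≤ (γ : EReal) * b + r' ↔
      a + ((1 / γ * r : ℝ) : EReal) ≤ b + ((1 / γ * r' : ℝ) : EReal) := by
  induction a <;> induction b <;>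
    simp only [EReal.coe_mul_top_of_pos hγ, EReal.coe_mul_bot_of_pos hγ, EReal.bot_add,
      EReal.top_add_coe, bot_le, le_top, ← EReal.coe_mul, ← EReal.coe_add, top_le_iff, le_bot_iff,
      EReal.coe_ne_top, EReal.coe_ne_bot, top_ne_bot, EReal.coe_le_coe_iff]
  rename_i a b
  rw [← mul_le_mul_iff_right₀ (one_div_pos.2 hγ), mul_add, mul_add, ← mul_assoc, ← mul_assoc,
    one_div_mul_cancel hγ.ne', one_mul, one_mul]

/-- Proximal problems are treated as `z`-subproblems with `B` the identity and `c = 0`. -/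
theorem proxScaled_eq_zSolutions {γ : ℝ} (hγ : 0 < γ) (φ : E → EReal) (s : E) :
    proxScaled γ φ s = zSolutions γ φ (ContinuousLinearMap.id ℝ E) 0 s := by
  ext u
  refine forall_congr' fun w => ?_
  rw [scaled_add_coe_le_iff hγ]
  simp only [ContinuousLinearMap.id_apply, add_zero, norm_sub_rev s]
  rw [← mul_assoc, ← mul_assoc, show 1 / γ * (1 / 2) = 1 / (2 * γ) by field_simp]

theorem xSolutions_eq_zSolutions (γ : ℝ) (f : X → EReal) (A : X →L[ℝ] E) (s : E) :
    xSolutions γ f A s = zSolutions γ f A 0 s := by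
  simp [xSolutions, zSolutions]

theorem exists_coe_of_mem_zSolutions {γ : ℝ} {g : Z → EReal} (hg : Proper g) {B : Z →L[ℝ] E}
    {c s : E} {z : Z} (hz : z ∈ zSolutions γ g B c s) : ∃ h : ℝ, g z = h := by
  obtain ⟨w, hw⟩ := hg.2
  have h := hz w
  lift g w to ℝ using ⟨hw, hg.1 w⟩ with r
  have ht : g z ≠ ⊤ := by
    intro ht
    rw [ht, EReal.top_add_coe, top_le_iff, ← EReal.coe_add] at h
    exact EReal.coe_ne_top _ h
  exact ⟨_, (EReal.coe_toReal ht (hg.1 z)).symm⟩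

/-- At a finite value, minimality can be stated without extended-real addition. -/
theorem mem_zSolutions_iff_of_coe {γ : ℝ} {g : Z → EReal} {B : Z →L[ℝ] E}
    {c s : E} {z : Z} {h : ℝ} (hz : g z = h) :
    z ∈ zSolutions γ g B c s ↔ ∀ w,
      ((h + 1 / (2 * γ) * (‖B z + c - s‖ ^ 2 - ‖B w + c - s‖ ^ 2) : ℝ) : EReal) ≤ g w := by
  refine forall_congr' fun w => ?_
  beta_reduce
  rw [hz]
  induction hw : g w
  · simp only [EReal.bot_add, le_bot_iff, ← EReal.coe_add, EReal.coe_ne_bot]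
  · norm_cast
    constructor <;> intro h <;> linarith
  · simp only [EReal.top_add_coe, le_top]

/-- Minimizing out the fibres of `z ↦ B z + c` in a subproblem leaves the proximal problem of the
image function, and a minimizer of the former attains the image function's infimum. -/
theorem imageFun_of_mem_zSolutions {γ : ℝ} {g : Z → EReal} {B : Z →L[ℝ] E}
    {c s : E} {z : Z} {h : ℝ} (hz : g z = h) (hmem : z ∈ zSolutions γ g B c s) :
    imageFun B g (B z + c - c) = h ∧
      B z + c ∈ zSolutions γ (fun t => imageFun B g (t - c)) (ContinuousLinearMap.id ℝ E) 0 s := by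
  rw [mem_zSolutions_iff_of_coe hz] at hmem
  have hval : imageFun B g (B z + c - c) = h := by
    refine le_antisymm (hz ▸ iInf₂_le z (by simp)) (le_iInf₂ fun y hy => ?_)
    have := hmem y
    rw [hy] at this
    simpa using this
  refine ⟨hval, ?_⟩
  rw [mem_zSolutions_iff_of_coe (g := fun t => imageFun B g (t - c)) hval]
  refine fun w => le_iInf₂ fun y hy => ?_
  simpa [hy] using hmem y

theorem le_coe_of_tendsto_of_lowerSemicontinuous {Z : Type*} [TopologicalSpace Z]
    {g : Z → EReal} (hg : LowerSemicontinuous g)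
    {z : ℕ → Z} {z' : Z} {r : ℕ → ℝ} {M : ℝ} (hz : Tendsto z atTop (𝓝 z'))
    (hr : Tendsto r atTop (𝓝 M)) (h : ∀ i, g (z i) ≤ (r i : EReal)) : g z' ≤ (M : EReal) := by
  refine le_of_forall_lt_imp_le_of_dense fun a ha => ?_
  refine ge_of_tendsto (continuous_coe_real_ereal.continuousAt.tendsto.comp hr) ?_
  filter_upwards [hz.eventually (hg z' a ha)] with i hi using hi.le.trans (h i)

theorem coe_bound_of_mem_zSolutions {γ : ℝ} {g : Z → EReal} (hg : Proper g) {B : Z →L[ℝ] E}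
    {c s : E} {z w : Z} {r : ℝ} (hz : z ∈ zSolutions γ g B c s) (hw : g w = r) :
    g z ≤ ((r + 1 / (2 * γ) * (‖B w + c - s‖ ^ 2 - ‖B z + c - s‖ ^ 2) : ℝ) : EReal) := by
  obtain ⟨h, hh⟩ := exists_coe_of_mem_zSolutions hg hz
  have := (mem_zSolutions_iff_of_coe hh).1 hz w
  rw [hw] at this
  rw [hh]
  norm_cast at this ⊢
  linarith

theorem mem_zSolutions_of_tendsto {γ : ℝ} {g : Z → EReal} (hg : Proper g)
    (hlsc : LowerSemicontinuous g) {B : Z →L[ℝ] E} {c : E} {z : ℕ → Z} {z' : Z}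
    {s : ℕ → E} {s' : E} (hmem : ∀ i, z i ∈ zSolutions γ g B c (s i))
    (hz : Tendsto z atTop (𝓝 z')) (hs : Tendsto s atTop (𝓝 s')) :
    z' ∈ zSolutions γ g B c s' := by
  have hBz : Tendsto (fun i => B (z i)) atTop (𝓝 (B z')) := (B.continuous.tendsto z').comp hz
  have hlim : ∀ w (r : ℝ), g w = r →
      g z' ≤ ((r + 1 / (2 * γ) * (‖B w + c - s'‖ ^ 2 - ‖B z' + c - s'‖ ^ 2) : ℝ) : EReal) := by
    intro w r hw
    refine le_coe_of_tendsto_of_lowerSemicontinuous hlsc hz ?_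
      fun i => coe_bound_of_mem_zSolutions hg (hmem i) hw
    exact ((((hs.const_sub _).norm.pow 2).sub
      (((hBz.add_const c).sub hs).norm.pow 2)).const_mul _).const_add r
  obtain ⟨w₀, hw₀⟩ := hg.2
  have hfin : g z' ≠ ⊤ := ne_top_of_le_ne_top (EReal.coe_ne_top _)
    (hlim w₀ _ (EReal.coe_toReal hw₀ (hg.1 w₀)).symm)
  have hz' : g z' = ((g z').toReal : EReal) := (EReal.coe_toReal hfin (hg.1 z')).symm
  rw [mem_zSolutions_iff_of_coe hz']
  intro w
  by_cases hw : g w = ⊤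
  · rw [hw]; exact le_top
  · have hw' := (EReal.coe_toReal hw (hg.1 w)).symm
    have := hlim w _ hw'
    rw [hz'] at this
    rw [hw']
    norm_cast at this ⊢
    linarith

/-- A minimizer of a quadratic perturbation has a proximal, hence regular, subgradient. -/
theorem subgradient_of_mem_zSolutions [CompleteSpace Z] [CompleteSpace E]
    {γ : ℝ} (hγ : 0 < γ) {g : Z → EReal} (hg : Proper g)
    {B : Z →L[ℝ] E} {c s : E} {z : Z} (hmem : z ∈ zSolutions γ g B c s) :
    (1 / γ) • ContinuousLinearMap.adjoint B (s - (B z + c)) ∈ subdifferential g z := by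
  obtain ⟨h, hz⟩ := exists_coe_of_mem_zSolutions hg hmem
  rw [mem_zSolutions_iff_of_coe hz] at hmem
  have hbot : g z ≠ ⊥ := hg.1 z
  have htop : g z ≠ ⊤ := hz ▸ EReal.coe_ne_top h
  refine ⟨hbot, htop, fun _ => z, fun _ => _, tendsto_const_nhds, tendsto_const_nhds, fun _ => ?_,
    tendsto_const_nhds⟩
  refine ⟨hbot, htop, fun ε hε => ?_⟩
  have hsmall : ∀ᶠ w in 𝓝 z, 1 / (2 * γ) * ‖B‖ ^ 2 * ‖w - z‖ < ε := by
    have hc : Continuous fun w : Z => 1 / (2 * γ) * ‖B‖ ^ 2 * ‖w - z‖ := by fun_prop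
    exact hc.continuousAt.eventually_lt continuousAt_const (by simpa using hε)
  filter_upwards [hsmall] with w hw
  refine le_trans ?_ (hmem w)
  rw [hz]
  norm_cast
  have hBw : B w + c - s = (B z + c - s) + B (w - z) := by rw [map_sub]; abel
  have hBn : ‖B (w - z)‖ ^ 2 ≤ ‖B‖ ^ 2 * ‖w - z‖ ^ 2 := by
    rw [← mul_pow]; exact pow_le_pow_left₀ (norm_nonneg _) (B.le_opNorm _) 2
  rw [hBw, norm_add_sq_real, inner_smul_left, ContinuousLinearMap.adjoint_inner_left,
    ← neg_sub (B z + c) s, inner_neg_left, conj_trivial]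
  have h1 := mul_le_mul_of_nonneg_left hBn (by positivity : 0 ≤ 1 / (2 * γ))
  have h2 := mul_le_mul_of_nonneg_right hw.le (norm_nonneg (w - z))
  have h3 : 1 / γ = 2 * (1 / (2 * γ)) := by field_simp
  rw [h3]
  nlinarith

end Prox

/-! ### The Douglas–Rachford envelope -/

section Envelope

variable {E : Type*} [NormedAddCommGroup E] [InnerProductSpace ℝ E] [CompleteSpace E]

/-- The standing assumptions on the smooth summary function, with its real-valued version `F` and
with moduli normalized to `-L < σ ≤ 0 < L`. -/
structure IsSmoothPart (φ : E → EReal) (F : E → ℝ) (γ L σ : ℝ) : Prop where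
  coe : ∀ x, φ x = F x
  hasGradientAt : ∀ x, HasGradientAt F (grad φ x) x
  lipschitz : ∀ x y, ‖grad φ x - grad φ y‖ ≤ L * ‖x - y‖
  mono : ∀ x y, σ * ‖x - y‖ ^ 2 ≤ inner ℝ (grad φ x - grad φ y) (x - y)
  γ_pos : 0 < γ
  L_pos : 0 < L
  neg_L_lt : -L < σ
  σ_nonpos : σ ≤ 0
  γ_mul_L : γ * L < 1
  γ_mul_σ : -(2 * γ * σ) < 1

/-- The moduli can be relaxed to `L' = (L + 1 / γ) / 2`, still below `1 / γ`, and
`σ' = min σ 0`. -/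
theorem IsSmoothPart.of_isLSmooth {φ : E → EReal} {γ L σ : ℝ} (hγ : 0 < γ)
    (hlow : -L ≤ σ) (hup : σ ≤ L) (hs : IsLSmooth L φ) (hh : IsHypoconvex σ φ)
    (hγσ : γ * (2 * max (-σ) 0) < 1) (hγL : γ * L < 1) :
    IsSmoothPart φ (fun x => (φ x).toReal) γ ((L + 1 / γ) / 2) (min σ 0) := by
  have hL0 : 0 ≤ L := by linarith
  have h1γ : 0 < 1 / γ := one_div_pos.2 hγ
  have hγ1 : γ * (1 / γ) = 1 := mul_one_div_cancel hγ.ne'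
  have hLγ : L < 1 / γ := by rw [lt_div_iff₀ hγ, mul_comm]; exact hγL
  have hmax : max (-σ) 0 = -min σ 0 := by rw [← neg_zero, max_neg_neg, neg_zero]
  refine ⟨fun x => (EReal.coe_toReal (hs.1 x).2 (hs.1 x).1).symm,
    fun x => (hs.2.1 x).hasGradientAt,
    fun x y => (hs.2.2 x y).trans
      (mul_le_mul_of_nonneg_right (by linarith) (norm_nonneg _)),
    fun x y => (mul_le_mul_of_nonneg_right (min_le_left _ _) (by positivity)).trans (hh.2.2 x y),
    hγ, by linarith, lt_min (by linarith) (by linarith), min_le_right _ _, ?_, ?_⟩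
  · linarith
  · rw [hmax] at hγσ; linarith

namespace IsSmoothPart

variable {φ₁ φ₂ : E → EReal} {F : E → ℝ} {γ L σ : ℝ}

theorem proper (S : IsSmoothPart φ₁ F γ L σ) : Proper φ₁ :=
  ⟨fun x => S.coe x ▸ EReal.coe_ne_bot _, 0, S.coe 0 ▸ EReal.coe_ne_top _⟩

/-- The optimality condition of the proximal mapping. Minimality and the descent lemma squeeze the
linear form of the residual `r = u + γ ∇φ₁ u - s` against a quadratic, which forces `r = 0`. -/
theorem eq_add_smul_grad (S : IsSmoothPart φ₁ F γ L σ) {s u : E} (hu : u ∈ proxScaled γ φ₁ s) :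
    s = u + γ • grad φ₁ u := by
  have hγ := S.γ_pos
  have hL := S.L_pos
  rw [proxScaled_eq_zSolutions hγ, mem_zSolutions_iff_of_coe (S.coe u)] at hu
  have key : ∀ d : E, 0 ≤ inner ℝ (u + γ • grad φ₁ u - s) d + ‖d‖ ^ 2 := by
    intro d
    have h1 := hu (u + d)
    rw [S.coe] at h1
    simp only [ContinuousLinearMap.id_apply, add_zero] at h1
    norm_cast at h1
    have h2 := quadratic_upper_bound S.hasGradientAt S.lipschitz u (u + d)
    rw [add_sub_cancel_left] at h2
    rw [show u + d - s = (u - s) + d by abel, norm_add_sq_real] at h1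
    rw [show u + γ • grad φ₁ u - s = (u - s) + γ • grad φ₁ u by abel, inner_add_left,
      inner_smul_left, conj_trivial]
    have h3 := mul_le_mul_of_nonneg_left (h1.trans h2) hγ.le
    have h4 : γ * (1 / (2 * γ)) = 1 / 2 := by field_simp
    have h5 := mul_le_mul_of_nonneg_right S.γ_mul_L.le (sq_nonneg ‖d‖)
    rw [mul_add, ← mul_assoc, h4] at h3
    nlinarith
  -- `d = -r / 2` minimizes `⟪r, d⟫ + ‖d‖²`
  have h := key (-((1 / 2 : ℝ) • (u + γ • grad φ₁ u - s)))
  rw [inner_neg_right, inner_smul_right, real_inner_self_eq_norm_sq, norm_neg, norm_smul,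
    mul_pow] at h
  have h0 : ‖u + γ • grad φ₁ u - s‖ ^ 2 ≤ 0 := by norm_num at h; linarith
  have h1 : ‖u + γ • grad φ₁ u - s‖ = 0 :=
    (pow_eq_zero_iff two_ne_zero).1 (le_antisymm h0 (by positivity))
  exact (sub_eq_zero.1 (norm_eq_zero.1 h1)).symm

/-- The proximal mapping is `2`-Lipschitz, because `u ↦ u + γ ∇φ₁ u` is strongly monotone with
modulus `1 + γ σ > 1 / 2`. -/
theorem norm_sub_le_of_mem_prox (S : IsSmoothPart φ₁ F γ L σ) {s s' u u' : E}
    (hu : u ∈ proxScaled γ φ₁ s) (hu' : u' ∈ proxScaled γ φ₁ s') :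
    ‖u - u'‖ ≤ 2 * ‖s - s'‖ := by
  have hs := S.eq_add_smul_grad hu
  have hs' := S.eq_add_smul_grad hu'
  have h1 : inner ℝ (s - s') (u - u') =
      ‖u - u'‖ ^ 2 + γ * inner ℝ (grad φ₁ u - grad φ₁ u') (u - u') := by
    rw [← real_inner_self_eq_norm_sq, ← real_inner_smul_left, ← inner_add_left]
    congr 1
    rw [hs, hs', smul_sub]
    abel_nf
  have h2 := mul_le_mul_of_nonneg_left (S.mono u u') S.γ_pos.le
  have h3 := real_inner_le_norm (s - s') (u - u')
  have h4 := S.γ_mul_σ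
  have h5 : ‖u - u'‖ * ‖u - u'‖ ≤ 2 * ‖s - s'‖ * ‖u - u'‖ := by nlinarith [sq_nonneg ‖u - u'‖]
  rcases (norm_nonneg (u - u')).eq_or_lt with h | h
  · rw [← h]; positivity
  · exact le_of_mul_le_mul_right h5 h

theorem proxScaled_eq_singleton (S : IsSmoothPart φ₁ F γ L σ) {s u : E}
    (hu : u ∈ proxScaled γ φ₁ s) : proxScaled γ φ₁ s = {u} := by
  refine Set.eq_singleton_iff_unique_mem.2 ⟨hu, fun w hw => ?_⟩
  have := S.norm_sub_le_of_mem_prox hw hu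
  simpa [sub_eq_zero] using this

theorem drEnvelope_le (S : IsSmoothPart φ₁ F γ L σ) {s u w : E} {h : ℝ}
    (hu : u ∈ proxScaled γ φ₁ s) (hw : φ₂ w = h) :
    drEnvelope γ φ₁ φ₂ s ≤
      ((F u + h + inner ℝ (grad φ₁ u) (w - u) + 1 / (2 * γ) * ‖w - u‖ ^ 2 : ℝ) : EReal) := by
  refine (iInf₂_le u hu).trans ((iInf_le _ w).trans_eq ?_)
  rw [envelopeModel, S.coe, hw, add_assoc (F u + h)]
  norm_cast

/-- The second proximal step attains the minimum in the envelope: completing the square, the model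
based at `u` is `φ₂ w + ‖w - (u - γ ∇φ₁ u)‖² / (2γ)` up to a constant, and
`u - γ ∇φ₁ u = 2 u - s`. -/
theorem drEnvelope_eq (S : IsSmoothPart φ₁ F γ L σ) {s u v : E} {h : ℝ}
    (hu : u ∈ proxScaled γ φ₁ s) (hv : v ∈ proxScaled γ φ₂ ((2 : ℝ) • u - s)) (hh : φ₂ v = h) :
    drEnvelope γ φ₁ φ₂ s =
      ((F u + h + inner ℝ (grad φ₁ u) (v - u) + 1 / (2 * γ) * ‖v - u‖ ^ 2 : ℝ) : EReal) := by
  have hγ := S.γ_pos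
  refine le_antisymm (S.drEnvelope_le hu hh) ?_
  rw [proxScaled_eq_zSolutions hγ, mem_zSolutions_iff_of_coe hh] at hv
  rw [drEnvelope, S.proxScaled_eq_singleton hu]
  simp only [Set.mem_singleton_iff, iInf_iInf_eq_left]
  refine le_iInf fun w => ?_
  have h1 := hv w
  have hsq : ∀ y : E, 1 / (2 * γ) * ‖y - ((2 : ℝ) • u - s)‖ ^ 2 =
      inner ℝ (grad φ₁ u) (y - u) + 1 / (2 * γ) * ‖y - u‖ ^ 2 + γ / 2 * ‖grad φ₁ u‖ ^ 2 := by
    intro y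
    have : y - ((2 : ℝ) • u - s) = (y - u) + γ • grad φ₁ u := by
      rw [S.eq_add_smul_grad hu, two_smul]; abel
    rw [this, norm_add_sq_real, inner_smul_right, norm_smul, mul_pow, Real.norm_eq_abs, sq_abs,
      real_inner_comm]
    field_simp
    ring
  simp only [ContinuousLinearMap.id_apply, add_zero, mul_sub, hsq] at h1
  rw [envelopeModel, S.coe]
  induction hw : φ₂ w
  · rw [hw, le_bot_iff] at h1
    exact absurd h1 (EReal.coe_ne_bot _)
  · rw [hw] at h1
    norm_cast at h1 ⊢
    linarith
  · rw [EReal.coe_add_top, EReal.top_add_coe]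
    exact le_top

/-- Adding `φ₂ v` shows that `φ₁ v + φ₂ v` is a lower bound of the envelope value. -/
theorem le_envelope_value (S : IsSmoothPart φ₁ F γ L σ) (u v : E) :
    F v ≤ F u + inner ℝ (grad φ₁ u) (v - u) + 1 / (2 * γ) * ‖v - u‖ ^ 2 := by
  have h := quadratic_upper_bound S.hasGradientAt S.lipschitz u v
  have h1 : L / 2 ≤ 1 / (2 * γ) := by
    rw [div_le_div_iff₀ two_pos (mul_pos two_pos S.γ_pos)]
    linarith [S.γ_mul_L]
  have := mul_le_mul_of_nonneg_right h1 (sq_nonneg ‖v - u‖)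
  linarith

/-- Sufficient decrease of the envelope along an un-accelerated step. -/
theorem drEnvelope_decrease (S : IsSmoothPart φ₁ F γ L σ) {s u v u' : E} {h : ℝ}
    (hu : u ∈ proxScaled γ φ₁ s) (hv : v ∈ proxScaled γ φ₂ ((2 : ℝ) • u - s)) (hh : φ₂ v = h)
    (hu' : u' ∈ proxScaled γ φ₁ (s + v - u)) :
    drEnvelope γ φ₁ φ₂ (s + v - u) + ((decreaseConst γ L σ * ‖v - u‖ ^ 2 : ℝ) : EReal) ≤
      drEnvelope γ φ₁ φ₂ s := by
  have hγ := S.γ_pos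
  have hs := S.eq_add_smul_grad hu
  have hs' := S.eq_add_smul_grad hu'
  have hvu : v - u = (u' - u) + γ • (grad φ₁ u' - grad φ₁ u) := by
    rw [smul_sub, eq_sub_of_add_eq' hs'.symm, eq_sub_of_add_eq' hs.symm]; abel
  have hvu' : v - u' = γ • (grad φ₁ u' - grad φ₁ u) := by
    rw [← sub_eq_zero, ← sub_eq_zero.2 hvu]; abel
  have key := sufficient_decrease_smooth S.hasGradientAt S.lipschitz S.mono hγ S.L_pos S.neg_L_lt
    S.σ_nonpos S.γ_mul_L S.γ_mul_σ u u'
  rw [← hvu] at key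
  rw [S.drEnvelope_eq hu hv hh]
  refine (add_le_add_left (S.drEnvelope_le hu' hh) _).trans ?_
  norm_cast
  refine le_of_sub_nonneg (le_trans (sub_nonneg.2 key) (le_of_eq ?_))
  rw [hvu', hvu, norm_add_sq_real]
  generalize hd : u' - u = d
  generalize he : grad φ₁ u' - grad φ₁ u = e
  have hge : grad φ₁ u' = grad φ₁ u + e := by rw [← he]; abel
  rw [← neg_sub u' u, hd, hge]
  simp only [inner_add_left, inner_add_right, inner_smul_right, inner_neg_right, norm_smul, mul_pow,
    Real.norm_eq_abs, sq_abs, real_inner_self_eq_norm_sq, real_inner_comm d e]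
  field_simp
  ring

end IsSmoothPart
end Envelope

/-! ### Convergence of descending proximal iterations -/

theorem tendsto_zero_of_sufficient_decrease {a r : ℕ → ℝ} {C b : ℝ} (hC : 0 < C)
    (hr : ∀ k, 0 ≤ r k) (hdec : ∀ k, a (k + 1) + C * r k ^ 2 ≤ a k) (hb : ∀ k, b ≤ a k) :
    Tendsto r atTop (𝓝 0) := by
  have hanti : Antitone a := antitone_nat_of_succ_le fun k =>
    (le_add_of_nonneg_right (by positivity)).trans (hdec k)
  have hlim := tendsto_atTop_ciInf hanti ⟨b, by rintro _ ⟨k, rfl⟩; exact hb k⟩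
  have hdiff : Tendsto (fun k => (a k - a (k + 1)) / C) atTop (𝓝 0) := by
    simpa using (hlim.sub (hlim.comp (tendsto_add_atTop_nat 1))).div_const C
  have hsq : Tendsto (fun k => r k ^ 2) atTop (𝓝 0) := by
    refine squeeze_zero (fun k => by positivity) (fun k => ?_) hdiff
    rw [le_div_iff₀ hC]
    linarith [hdec k]
  simpa [Real.sqrt_sq, hr] using hsq.sqrt

section Sequences

variable {E : Type*} [NormedAddCommGroup E] [InnerProductSpace ℝ E] [CompleteSpace E]

/-- Sequences of proximal steps along which the envelope decreases by a multiple of the squared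
residual. The choice of `s (k + 1)` enters the convergence analysis only through this decrease. -/
structure IsDescentRun (φ₁ φ₂ : E → EReal) (γ C : ℝ) (s u v : ℕ → E) : Prop where
  u_mem : ∀ k, u k ∈ proxScaled γ φ₁ (s k)
  v_mem : ∀ k, v k ∈ proxScaled γ φ₂ ((2 : ℝ) • u k - s k)
  decrease : ∀ k, drEnvelope γ φ₁ φ₂ (s (k + 1)) + ((C * ‖v k - u k‖ ^ 2 : ℝ) : EReal) ≤
    drEnvelope γ φ₁ φ₂ (s k)

namespace IsDescentRun

variable {φ₁ φ₂ : E → EReal} {F : E → ℝ} {γ L σ C : ℝ} {s u v : ℕ → E}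

/-- The envelope is finite along the run and dominates `φ₁ + φ₂` at `v k`. -/
theorem exists_coe (R : IsDescentRun φ₁ φ₂ γ C s u v) (S : IsSmoothPart φ₁ F γ L σ)
    (hφ₂ : Proper φ₂) (k : ℕ) :
    ∃ a : ℝ, drEnvelope γ φ₁ φ₂ (s k) = a ∧ φ₁ (v k) + φ₂ (v k) ≤ a := by
  have hv := R.v_mem k
  rw [proxScaled_eq_zSolutions S.γ_pos] at hv
  obtain ⟨h, hh⟩ := exists_coe_of_mem_zSolutions hφ₂ hv
  refine ⟨_, S.drEnvelope_eq (R.u_mem k) (R.v_mem k) hh, ?_⟩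
  rw [S.coe, hh]
  norm_cast
  linarith [S.le_envelope_value (u k) (v k)]

theorem antitone (R : IsDescentRun φ₁ φ₂ γ C s u v) (hC : 0 < C) :
    Antitone fun k => drEnvelope γ φ₁ φ₂ (s k) := by
  refine antitone_nat_of_succ_le fun k => le_trans ?_ (R.decrease k)
  refine le_add_of_nonneg_right ?_
  exact_mod_cast (by positivity : (0 : ℝ) ≤ C * ‖v k - u k‖ ^ 2)

theorem tendsto_residual (R : IsDescentRun φ₁ φ₂ γ C s u v) (S : IsSmoothPart φ₁ F γ L σ)
    (hφ₂ : Proper φ₂) (hC : 0 < C) (hsol : (argMin fun t => φ₁ t + φ₂ t).Nonempty) :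
    Tendsto (fun k => ‖v k - u k‖) atTop (𝓝 0) := by
  choose a ha hle using R.exists_coe S hφ₂
  obtain ⟨t, ht⟩ := hsol
  have hbound : ∀ k, φ₁ t + φ₂ t ≤ a k := fun k => (ht (v k)).trans (hle k)
  have hbot : φ₁ t + φ₂ t ≠ ⊥ := by
    rw [Ne, EReal.add_eq_bot_iff]
    exact not_or.2 ⟨S.proper.1 t, hφ₂.1 t⟩
  have htop : φ₁ t + φ₂ t ≠ ⊤ := ne_top_of_le_ne_top (EReal.coe_ne_top _) (hbound 0)
  rw [← EReal.coe_toReal htop hbot] at hbound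
  refine tendsto_zero_of_sufficient_decrease hC (fun k => norm_nonneg _) (fun k => ?_)
    (fun k => EReal.coe_le_coe_iff.1 (hbound k))
  have := R.decrease k
  rw [ha, ha] at this
  exact_mod_cast this

theorem exists_bounds (R : IsDescentRun φ₁ φ₂ γ C s u v) (S : IsSmoothPart φ₁ F γ L σ)
    (hφ₂ : Proper φ₂) (hC : 0 < C) (hsol : (argMin fun t => φ₁ t + φ₂ t).Nonempty)
    (hlevel : LevelBounded fun t => φ₁ t + φ₂ t) :
    ∃ M : ℝ, ∀ k, ‖s k‖ ≤ M ∧ ‖u k‖ ≤ M ∧ ‖v k‖ ≤ M := by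
  choose a ha hle using R.exists_coe S hφ₂
  obtain ⟨V, hV⟩ := (hlevel (a 0)).exists_norm_le
  have hv : ∀ k, ‖v k‖ ≤ V := fun k => hV _ <| by
    refine (hle k).trans ?_
    rw [← ha k, ← ha 0]
    exact R.antitone hC (Nat.zero_le k)
  obtain ⟨D, hD⟩ := (R.tendsto_residual S hφ₂ hC hsol).bddAbove_range
  have hu : ∀ k, ‖u k‖ ≤ V + D := fun k => by
    have h1 := norm_sub_le (v k) (v k - u k)
    rw [sub_sub_cancel] at h1
    exact h1.trans (add_le_add (hv k) (hD ⟨k, rfl⟩))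
  have hs : ∀ k, ‖s k‖ ≤ (V + D) + γ * (L * (V + D) + ‖grad φ₁ 0‖) := fun k => by
    rw [S.eq_add_smul_grad (R.u_mem k)]
    refine (norm_add_le _ _).trans (add_le_add (hu k) ?_)
    rw [norm_smul, Real.norm_of_nonneg S.γ_pos.le]
    refine mul_le_mul_of_nonneg_left ?_ S.γ_pos.le
    have h1 := norm_add_le (grad φ₁ (u k) - grad φ₁ 0) (grad φ₁ 0)
    rw [sub_add_cancel] at h1
    have h2 := S.lipschitz (u k) 0
    rw [sub_zero] at h2
    linarith [mul_le_mul_of_nonneg_left (hu k) S.L_pos.le]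
  exact ⟨max ((V + D) + γ * (L * (V + D) + ‖grad φ₁ 0‖)) (max (V + D) V), fun k =>
    ⟨(hs k).trans (le_max_left _ _), (hu k).trans ((le_max_left _ _).trans (le_max_right _ _)),
      (hv k).trans ((le_max_right _ _).trans (le_max_right _ _))⟩⟩

theorem tendsto_u (R : IsDescentRun φ₁ φ₂ γ C s u v) (S : IsSmoothPart φ₁ F γ L σ)
    {κ : ℕ → ℕ} {s' u' : E} (hs : Tendsto (fun i => s (κ i)) atTop (𝓝 s'))
    (hu' : u' ∈ proxScaled γ φ₁ s') : Tendsto (fun i => u (κ i)) atTop (𝓝 u') := by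
  rw [tendsto_iff_norm_sub_tendsto_zero] at hs ⊢
  exact squeeze_zero (fun _ => norm_nonneg _)
    (fun i => S.norm_sub_le_of_mem_prox (R.u_mem (κ i)) hu')
    (by simpa using hs.const_mul 2)

theorem tendsto_v (R : IsDescentRun φ₁ φ₂ γ C s u v) (S : IsSmoothPart φ₁ F γ L σ)
    (hφ₂ : Proper φ₂) (hC : 0 < C) (hsol : (argMin fun t => φ₁ t + φ₂ t).Nonempty)
    {κ : ℕ → ℕ} (hκ : StrictMono κ) {s' u' : E} (hs : Tendsto (fun i => s (κ i)) atTop (𝓝 s'))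
    (hu' : u' ∈ proxScaled γ φ₁ s') : Tendsto (fun i => v (κ i)) atTop (𝓝 u') := by
  have h1 := (tendsto_zero_iff_norm_tendsto_zero.2
    (R.tendsto_residual S hφ₂ hC hsol)).comp hκ.tendsto_atTop
  simpa using h1.add (R.tendsto_u S hs hu')

theorem limit_mem_prox (R : IsDescentRun φ₁ φ₂ γ C s u v) (S : IsSmoothPart φ₁ F γ L σ)
    (hφ₂ : Proper φ₂) (hlsc : LowerSemicontinuous φ₂) (hC : 0 < C)
    (hsol : (argMin fun t => φ₁ t + φ₂ t).Nonempty)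
    {κ : ℕ → ℕ} (hκ : StrictMono κ) {s' u' : E} (hs : Tendsto (fun i => s (κ i)) atTop (𝓝 s'))
    (hu' : u' ∈ proxScaled γ φ₁ s') : u' ∈ proxScaled γ φ₂ ((2 : ℝ) • u' - s') := by
  have hv : ∀ i, v (κ i) ∈ proxScaled γ φ₂ ((2 : ℝ) • u (κ i) - s (κ i)) := fun i => R.v_mem (κ i)
  simp only [proxScaled_eq_zSolutions S.γ_pos φ₂] at hv ⊢
  exact mem_zSolutions_of_tendsto hφ₂ hlsc hv (R.tendsto_v S hφ₂ hC hsol hκ hs hu')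
    (((R.tendsto_u S hs hu').const_smul 2).sub hs)

end IsDescentRun

/-- At a fixed point the optimality conditions of the two proximal steps have opposite
subgradients. -/
theorem isStationaryDR_of_mem_prox {φ₁ φ₂ : E → EReal} {γ : ℝ} (hγ : 0 < γ) (h₁ : Proper φ₁)
    (h₂ : Proper φ₂) {s u : E} (hu : u ∈ proxScaled γ φ₁ s)
    (hv : u ∈ proxScaled γ φ₂ ((2 : ℝ) • u - s)) : IsStationaryDR φ₁ φ₂ u := by
  rw [proxScaled_eq_zSolutions hγ] at hu hv
  refine ⟨_, subgradient_of_mem_zSolutions hγ h₁ hu, _, subgradient_of_mem_zSolutions hγ h₂ hv, ?_⟩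
  have h : s - (ContinuousLinearMap.id ℝ E u + 0) +
      ((2 : ℝ) • u - s - (ContinuousLinearMap.id ℝ E u + 0)) = 0 := by
    simp only [ContinuousLinearMap.id_apply, two_smul]
    abel
  rw [← smul_add, ← map_add, h, map_zero, smul_zero]

end Sequences

/-! ### Runs of the accelerated algorithm -/

section Run

variable {X Z E : Type*}
  [NormedAddCommGroup X] [InnerProductSpace ℝ X]
  [NormedAddCommGroup Z] [InnerProductSpace ℝ Z]
  [NormedAddCommGroup E] [InnerProductSpace ℝ E]

theorem mem_prox_of_mem_xSolutions {γ : ℝ} (hγ : 0 < γ) {f : X → EReal} (hf : Proper f)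
    {A : X →L[ℝ] E} {s : E} {x : X} (hx : x ∈ xSolutions γ f A s) :
    A x ∈ proxScaled γ (imageFun A f) s := by
  rw [xSolutions_eq_zSolutions] at hx
  obtain ⟨h, hh⟩ := exists_coe_of_mem_zSolutions hf hx
  rw [proxScaled_eq_zSolutions hγ]
  simpa using (imageFun_of_mem_zSolutions hh hx).2

theorem mem_prox_of_mem_zSolutions {γ : ℝ} (hγ : 0 < γ) {g : Z → EReal} (hg : Proper g)
    {B : Z →L[ℝ] E} {c s : E} {z : Z} (hz : z ∈ zSolutions γ g B c s) :
    B z + c ∈ proxScaled γ (fun t => imageFun B g (t - c)) s := by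
  obtain ⟨h, hh⟩ := exists_coe_of_mem_zSolutions hg hz
  rw [proxScaled_eq_zSolutions hγ]
  exact (imageFun_of_mem_zSolutions hh hz).2

/-- An accepted candidate decreases the envelope by the acceptance test, a rejected one because the
un-accelerated step does. -/
theorem IsRun.isDescentRun [CompleteSpace E] {f : X → EReal} {g : Z → EReal}
    {A : X →L[ℝ] E} {B : Z →L[ℝ] E}
    {c : E} {γ ν₁ ν₂ L σ : ℝ} {m : ℕ} {xInit : X} {yInit : E} {s u v : ℕ → E} {x : ℕ → X}
    {z : ℕ → Z} {F : E → ℝ}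
    (hrun : IsRun f g A B c γ ν₁ ν₂ m xInit yInit s u v x z)
    (S : IsSmoothPart (imageFun A f) F γ L σ)
    (hf : Proper f) (hg : Proper g) (hφ₂ : Proper fun t => imageFun B g (t - c)) (hν₂ : 0 ≤ ν₂) :
    IsDescentRun (imageFun A f) (fun t => imageFun B g (t - c)) γ (min ν₁ (decreaseConst γ L σ))
      s u v := by
  have hu : ∀ k, u k ∈ proxScaled γ (imageFun A f) (s k) := fun k =>
    hrun.u_eq k ▸ mem_prox_of_mem_xSolutions S.γ_pos hf (hrun.x_mem k)
  have hv : ∀ k, v k ∈ proxScaled γ (fun t => imageFun B g (t - c)) ((2 : ℝ) • u k - s k) :=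
    fun k => hrun.v_eq k ▸ mem_prox_of_mem_zSolutions S.γ_pos hg (hrun.z_mem k)
  refine ⟨hu, hv, fun k => ?_⟩
  have hr := sq_nonneg ‖v k - u k‖
  obtain ⟨θ, -, ⟨hacc, hs⟩ | ⟨-, hs⟩⟩ := hrun.step k
  · rw [Accepted, ← hs, show s k + v k - u k - s k = v k - u k by abel] at hacc
    refine le_trans (add_le_add_right ?_ _) hacc
    norm_cast
    have h1 := mul_le_mul_of_nonneg_right (min_le_left ν₁ (decreaseConst γ L σ)) hr
    have h2 : 0 ≤ ν₂ * ‖s (k + 1) - s k‖ ^ 2 := by positivity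
    linarith
  · have hu' := hu (k + 1)
    rw [hs] at hu' ⊢
    have hvz := hv k
    rw [proxScaled_eq_zSolutions S.γ_pos] at hvz
    obtain ⟨h, hh⟩ := exists_coe_of_mem_zSolutions hφ₂ hvz
    refine le_trans (add_le_add_right ?_ _) (S.drEnvelope_decrease (hu k) (hv k) hh hu')
    norm_cast
    exact mul_le_mul_of_nonneg_right (min_le_right _ _) hr

theorem IsRun.isBounded_z [CompleteSpace E] {f : X → EReal} {g : Z → EReal}
    {A : X →L[ℝ] E} {B : Z →L[ℝ] E}
    {c : E} {γ ν₁ ν₂ M : ℝ} {m : ℕ} {xInit : X} {yInit : E} {s u v : ℕ → E} {x : ℕ → X}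
    {z : ℕ → Z} (hrun : IsRun f g A B c γ ν₁ ν₂ m xInit yInit s u v x z) (hγ : 0 < γ)
    (hg : Proper g)
    (hM : ∀ k, ‖s k‖ ≤ M ∧ ‖u k‖ ≤ M ∧ ‖v k‖ ≤ M)
    (hlevel : LevelBounded fun w => g w + ((1 / (2 * γ) * ‖B w + c - 0‖ ^ 2 : ℝ) : EReal)) :
    Bornology.IsBounded (Set.range z) := by
  obtain ⟨w, hw⟩ := hg.2
  have hw' := (EReal.coe_toReal hw (hg.1 w)).symm
  -- `z k` is compared with a fixed point `w` of the domain of `g`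
  refine (hlevel ((g w).toReal + 1 / (2 * γ) * (‖B w + c‖ + 3 * M) ^ 2 +
    1 / (2 * γ) * M ^ 2)).subset ?_
  rintro _ ⟨k, rfl⟩
  have hle := coe_bound_of_mem_zSolutions hg (hrun.z_mem k) hw'
  obtain ⟨h, hh⟩ := exists_coe_of_mem_zSolutions hg (hrun.z_mem k)
  obtain ⟨hs, hu, hv⟩ := hM k
  have hγ2 : 0 ≤ 1 / (2 * γ) := by positivity
  rw [Set.mem_ofPred_eq]
  beta_reduce
  rw [hh, sub_zero, ← hrun.v_eq]
  rw [hh, ← hrun.v_eq, EReal.coe_le_coe_iff] at hle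
  rw [← EReal.coe_add, EReal.coe_le_coe_iff]
  have h1 : ‖B w + c - ((2 : ℝ) • u k - s k)‖ ≤ ‖B w + c‖ + 3 * M := by
    have h2 := norm_sub_le (B w + c) ((2 : ℝ) • u k - s k)
    have h3 := norm_sub_le ((2 : ℝ) • u k) (s k)
    rw [norm_smul, Real.norm_ofNat] at h3
    linarith
  have h4 := mul_le_mul_of_nonneg_left (pow_le_pow_left₀ (norm_nonneg _) h1 2) hγ2
  have h5 := mul_le_mul_of_nonneg_left (pow_le_pow_left₀ (norm_nonneg _) hv 2) hγ2
  have h6 : 0 ≤ 1 / (2 * γ) * ‖v k - ((2 : ℝ) • u k - s k)‖ ^ 2 := by positivity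
  linarith

end Run

end AADR

open AADR in
theorem theorem4p1 {n q p : ℕ}
    (f : EuclideanSpace ℝ (Fin n) → EReal) (g : EuclideanSpace ℝ (Fin q) → EReal)
    (A : EuclideanSpace ℝ (Fin n) →L[ℝ] EuclideanSpace ℝ (Fin p))
    (B : EuclideanSpace ℝ (Fin q) →L[ℝ] EuclideanSpace ℝ (Fin p))
    (c : EuclideanSpace ℝ (Fin p))
    -- `f` and `g` are proper and lower semicontinuous
    (hf : Proper f) (hf_lsc : LowerSemicontinuous f)
    (hg : Proper g) (hg_lsc : LowerSemicontinuous g)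
    (β γ : ℝ) (hβ : 0 < β) (hγ : γ = 1 / β)
    -- the subproblems of the algorithm are solvable
    (hx_solv : ∀ t, (xSolutions γ f A t).Nonempty)
    (hz_solv : ∀ t, (zSolutions γ g B c t).Nonempty)
    (φ₁ φ₂ : EuclideanSpace ℝ (Fin p) → EReal)
    (hφ₁ : φ₁ = imageFun A f) (hφ₂ : φ₂ = fun t => imageFun B g (t - c))
    -- `φ₁` is `L`-smooth and `σ`-hypoconvex
    (L σ : ℝ) (hσ_lower : -L ≤ σ) (hσ_upper : σ ≤ L)
    (hsmooth : IsLSmooth L φ₁) (hhypo : IsHypoconvex σ φ₁)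
    -- `φ₂` is lower semicontinuous and proper
    (hφ₂_lsc : LowerSemicontinuous φ₂) (hφ₂_proper : Proper φ₂)
    -- `min φ₁ + φ₂` has a solution
    (hsol : (argMin fun t => φ₁ t + φ₂ t).Nonempty)
    -- constants of the acceptance test
    (ν₁ ν₂ : ℝ) (hν₁ : 0 < ν₁) (hν₂ : 0 ≤ ν₂)
    -- level-boundedness
    (hlevel : LevelBounded fun t => φ₁ t + φ₂ t)
    -- `γ < min {1 / (2 max {-σ, 0}), 1 / L}`, where `1 / 0 = +∞`
    (hγ_hypo : γ * (2 * max (-σ) 0) < 1) (hγ_smooth : γ * L < 1)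
    (m : ℕ) (xInit : EuclideanSpace ℝ (Fin n)) (yInit : EuclideanSpace ℝ (Fin p))
    (s u v : ℕ → EuclideanSpace ℝ (Fin p))
    (x : ℕ → EuclideanSpace ℝ (Fin n)) (z : ℕ → EuclideanSpace ℝ (Fin q))
    (hrun : IsRun f g A B c γ ν₁ ν₂ m xInit yInit s u v x z) :
    -- (a)
    ((∀ k, drEnvelope γ φ₁ φ₂ (s k) ≠ ⊥ ∧ drEnvelope γ φ₁ φ₂ (s k) ≠ ⊤) ∧
      Antitone (fun k => drEnvelope γ φ₁ φ₂ (s k)) ∧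
      Tendsto (fun k => ‖v k - u k‖) atTop (𝓝 0)) ∧
    -- (b)
    (Bornology.IsBounded (Set.range fun k => (s k, u k, v k)) ∧
      (∀ (κ : ℕ → ℕ) (s' : EuclideanSpace ℝ (Fin p)), StrictMono κ →
        Tendsto (fun i => s (κ i)) atTop (𝓝 s') →
        s' ∈ drMap γ φ₁ φ₂ s' ∧
          ∃ u', proxScaled γ φ₁ s' = {u'} ∧ IsStationaryDR φ₁ φ₂ u') ∧
      (∃ (κ : ℕ → ℕ) (s' : EuclideanSpace ℝ (Fin p)), StrictMono κ ∧
        Tendsto (fun i => s (κ i)) atTop (𝓝 s'))) ∧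
    -- (c), when every `z`-subproblem objective is level-bounded and bounded below
    ((∀ t : EuclideanSpace ℝ (Fin p),
        LevelBounded (fun w => g w + ((β / 2 * ‖B w + c - t‖ ^ 2 : ℝ) : EReal)) ∧
        ∃ b : ℝ, ∀ w, (b : EReal) ≤ g w + ((β / 2 * ‖B w + c - t‖ ^ 2 : ℝ) : EReal)) →
      ∀ (κ : ℕ → ℕ) (s' : EuclideanSpace ℝ (Fin p)), StrictMono κ →
        Tendsto (fun i => s (κ i)) atTop (𝓝 s') →
        Bornology.IsBounded (Set.range fun i => z (κ i)) ∧
        (∃ z', MapClusterPt z' atTop (fun i => z (κ i))) ∧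
        ∀ z', MapClusterPt z' atTop (fun i => z (κ i)) →
          ∀ u' ∈ proxScaled γ φ₁ s',
          ∀ x' ∈ argMin (fun w => f w + ((β / 2 * ‖A w - s'‖ ^ 2 : ℝ) : EReal)),
            IsStationaryADMM f g A B c β x' (u' - s') z') := by
  subst hφ₁ hφ₂
  have hγ0 : 0 < γ := hγ ▸ one_div_pos.2 hβ
  have hβγ : β / 2 = 1 / (2 * γ) := by rw [hγ]; field_simp
  have hβ' : β = 1 / γ := by rw [hγ, one_div_one_div]
  have S := IsSmoothPart.of_isLSmooth hγ0 hσ_lower hσ_upper hsmooth hhypo hγ_hypo hγ_smooth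
  have R := hrun.isDescentRun S hf hg hφ₂_proper hν₂
  have hC := lt_min hν₁ (decreaseConst_pos hγ0 S.L_pos S.σ_nonpos S.γ_mul_L S.γ_mul_σ)
  obtain ⟨M, hM⟩ := R.exists_bounds S hφ₂_proper hC hsol hlevel
  refine ⟨⟨fun k => ?_, R.antitone hC, R.tendsto_residual S hφ₂_proper hC hsol⟩,
    ⟨?_, fun κ s' hκ hs => ?_, ?_⟩, fun hz κ s' hκ hs => ?_⟩
  · obtain ⟨a, ha, -⟩ := R.exists_coe S hφ₂_proper k
    rw [ha]
    exact ⟨EReal.coe_ne_bot a, EReal.coe_ne_top a⟩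
  · refine isBounded_iff_forall_norm_le.2 ⟨M, ?_⟩
    rintro _ ⟨k, rfl⟩
    exact norm_prod_le_iff.2 ⟨(hM k).1, norm_prod_le_iff.2 (hM k).2⟩
  · obtain ⟨x', hx'⟩ := hx_solv s'
    have hu' := mem_prox_of_mem_xSolutions hγ0 hf hx'
    have hv' := R.limit_mem_prox S hφ₂_proper hφ₂_lsc hC hsol hκ hs hu'
    refine ⟨⟨_, hu', _, hv', ?_⟩, _, S.proxScaled_eq_singleton hu',
      isStationaryDR_of_mem_prox hγ0 S.proper hφ₂_proper hu' hv'⟩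
    rw [sub_sub_cancel, ← two_smul ℝ s', smul_smul]
    norm_num
  · obtain ⟨s', -, κ, hκ, hs⟩ := tendsto_subseq_of_bounded
      (isBounded_iff_forall_norm_le.2 ⟨M, Set.forall_mem_range.2 fun k => (hM k).1⟩)
      (fun k => Set.mem_range_self (f := s) k)
    exact ⟨κ, s', hκ, hs⟩
  · have hlevel_z := (hz 0).1
    rw [hβγ] at hlevel_z
    have hbdd : Bornology.IsBounded (Set.range fun i => z (κ i)) :=
      (hrun.isBounded_z hγ0 hg hM hlevel_z).subset
        (Set.range_subset_iff.2 fun i => Set.mem_range_self (κ i))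
    refine ⟨hbdd, ?_, fun z' hz' u' hu' x' hx' => ?_⟩
    · obtain ⟨z', -, ψ, hψ, hlim⟩ := tendsto_subseq_of_bounded hbdd
        (fun i => Set.mem_range_self (f := fun i => z (κ i)) i)
      exact ⟨z', MapClusterPt.of_comp hψ.tendsto_atTop hlim.mapClusterPt⟩
    · obtain ⟨ψ, hψ, hlim⟩ := hz'.tendsto_subseq
      rw [hβγ] at hx'
      have hAx : A x' = u' := by
        have h := mem_prox_of_mem_xSolutions hγ0 hf hx'
        rwa [S.proxScaled_eq_singleton hu'] at h
      have hs' : Tendsto (fun i => s (κ (ψ i))) atTop (𝓝 s') := hs.comp hψ.tendsto_atTop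
      have hu_lim := R.tendsto_u S (κ := κ ∘ ψ) hs' hu'
      have hv_lim := R.tendsto_v S hφ₂_proper hC hsol (hκ.comp hψ) hs' hu'
      have hzmem : z' ∈ zSolutions γ g B c ((2 : ℝ) • u' - s') :=
        mem_zSolutions_of_tendsto hg hg_lsc (fun i => hrun.z_mem (κ (ψ i))) hlim
          ((hu_lim.const_smul 2).sub hs')
      have hBz : B z' + c = u' := by
        refine tendsto_nhds_unique (((B.continuous.tendsto z').comp hlim).add_const c) ?_
        exact hv_lim.congr fun i => hrun.v_eq _
      refine ⟨?_, ?_, ?_⟩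
      · rw [hAx, ← hBz, add_sub_cancel_left]
      · have h := subgradient_of_mem_zSolutions hγ0 hf
          ((xSolutions_eq_zSolutions γ f A s').subset hx')
        rwa [add_zero, hAx, ← hβ', ← neg_sub u' s', map_neg, smul_neg] at h
      · have h := subgradient_of_mem_zSolutions hγ0 hg hzmem
        rwa [hBz, ← hβ', two_smul, show u' + u' - s' - u' = u' - s' by abel] at h
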